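/- For $n\ge 0$ let $q_n=x_1^2+\cdots+x_n^2\in\mathbb{C}[x_1,\dots,x_n]$. For a homogeneous polynomial $f\in\mathbb{C}[x_1,\dots,x_n]$ of degree $d$, the (Waring) rank $\operatorname{rk}(f)$ is the smallest natural number $r$ such that $f=\sum_{j=1}^r l_j^d$ for $r$ different linear forms $l_1,\dots,l_r\in\mathbb{C}[x_1,\dots,x_n]$. For natural numbers $k,s$ let $\mathrm{p}_k(s)$ be the number of partitions of $s$ into exactly $k$ parts. Then for every integer $n\ge 0$ and every integer $s\ge 1$, the form $q_n^s$ (regarded as a form of degree $2s$) has a decomposition as a sum of $2s$-th powers of finitely many linear forms, and $$\operatorname{rk}(q_n^s)\le\sum_{k=1}^s 2^k\,k!\,\mathrm{p}_k(s)\binom{n}{k}.$$ -/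

import Mathlib

/-- The quadratic form `q_n = x_1 ^ 2 + ⋯ + x_n ^ 2` over the complex numbers. -/
noncomputable def quadForm (n : ℕ) : MvPolynomial (Fin n) ℂ :=
  ∑ i : Fin n, MvPolynomial.X i ^ 2

/-- `f` is a sum of `d`-th powers of `r` different linear forms
(a Waring decomposition of `f` of size `r`, for `f` a form of degree `d`). -/
def HasWaringDecomposition {n : ℕ} (d : ℕ) (f : MvPolynomial (Fin n) ℂ) (r : ℕ) : Prop :=
  ∃ L : Finset (MvPolynomial (Fin n) ℂ),
    L.card = r ∧ (∀ l ∈ L, l.IsHomogeneous 1) ∧ f = ∑ l ∈ L, l ^ d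

/-- The Waring rank of a form `f` of degree `d`: the least size of a Waring decomposition.
It takes values in `ℕ∞` and is `⊤` if there is no decomposition at all, so that a finite
upper bound on it includes the existence of a decomposition. -/
noncomputable def waringRank {n : ℕ} (d : ℕ) (f : MvPolynomial (Fin n) ℂ) : ℕ∞ :=
  ⨅ (r : ℕ) (_ : HasWaringDecomposition d f r), (r : ℕ∞)

/-- The `k`-partition function: the number of partitions of `s` into exactly `k` parts. -/
def kPartition (k s : ℕ) : ℕ :=
  Fintype.card {p : s.Partition // p.parts.card = k}

open MvPolynomial Finset

theorem exists_hasWaringDecomposition_of_multiset {n d : ℕ} (hd : 0 < d)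
    (M : Multiset (MvPolynomial (Fin n) ℂ)) (hM : ∀ l ∈ M, l.IsHomogeneous 1) :
    ∃ r ≤ M.card, HasWaringDecomposition d (M.map (· ^ d)).sum r := by
  induction hm : M.card using Nat.strong_induction_on generalizing M with
  | _ m ih =>
    by_cases hnd : M.Nodup
    · exact ⟨m, le_rfl, ⟨M, hnd⟩, hm, hM, rfl⟩
    · rw [Multiset.nodup_iff_le] at hnd
      push Not at hnd
      obtain ⟨a, ha⟩ := hnd
      obtain ⟨N, rfl⟩ := Multiset.le_iff_exists_add.1 ha
      -- Two copies of `a` merge into one form, `2 a^d = (c a)^d`. It may collide with another form,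
      -- but the length has dropped.
      obtain ⟨c, hc⟩ := IsAlgClosed.exists_pow_nat_eq (2 : ℂ) hd
      obtain ⟨r, hr, h⟩ := ih (Multiset.card N + 1) (by subst hm; simp)
        ((C c * a) ::ₘ N) (by
          intro l hl
          rcases Multiset.mem_cons.1 hl with rfl | hl
          · exact (hM a (by simp)).C_mul c
          · exact hM l (by simp [hl])) (by simp)
      refine ⟨r, hr.trans (by subst hm; simp), ?_⟩
      convert h using 1
      have h2 : (C (2 : ℂ) : MvPolynomial (Fin n) ℂ) = 2 := map_ofNat _ 2
      simp [mul_pow, ← map_pow, hc, h2]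
      ring

/-- A linear combination of `d`-th powers of linear forms bounds the Waring rank by its length. -/
theorem waringRank_sum_le_card {n d : ℕ} (hd : 0 < d) {ι : Type*} (I : Finset ι) (c : ι → ℂ)
    (l : ι → MvPolynomial (Fin n) ℂ) (hl : ∀ i ∈ I, (l i).IsHomogeneous 1) :
    waringRank d (∑ i ∈ I, C (c i) * l i ^ d) ≤ (I.card : ℕ∞) := by
  choose z hz using fun i => IsAlgClosed.exists_pow_nat_eq (c i) hd
  obtain ⟨r, hr, h⟩ := exists_hasWaringDecomposition_of_multiset hd
    (I.val.map fun i => C (z i) * l i) (by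
      intro m hm
      obtain ⟨i, hi, rfl⟩ := Multiset.mem_map.1 hm
      exact (hl i hi).C_mul _)
  have hsum : ((I.val.map fun i => C (z i) * l i).map (· ^ d)).sum
      = ∑ i ∈ I, C (c i) * l i ^ d := by
    rw [Multiset.map_map]
    exact Finset.sum_congr rfl fun i _ => by simp [mul_pow, ← map_pow, hz]
  rw [hsum] at h
  rw [Multiset.card_map] at hr
  exact (iInf₂_le r h).trans (by exact_mod_cast hr)

/-! ### Interpolation at the lattice points of the simplex -/

/-- The evaluation of a form, as a sum over all monomials of its degree. -/
theorem eval_eq_sum_piAntidiag {n s : ℕ} {f : MvPolynomial (Fin n) ℂ} (hf : f.IsHomogeneous s)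
    (x : Fin n → ℂ) :
    eval x f = ∑ b ∈ piAntidiag univ s,
      f.coeff (Finsupp.equivFunOnFinite.symm b) * ∏ i, x i ^ b i := by
  rw [eval_eq']
  refine Finset.sum_bij_ne_zero (fun d _ _ => (d : Fin n → ℕ)) ?_ ?_ ?_ ?_
  · intro d hd _
    have := hf.degree_eq_sum_deg_support hd
    simp only [mem_piAntidiag, mem_univ, implies_true, and_true]
    rw [this]
    exact (sum_subset (subset_univ _) fun i _ hi => by simpa using hi).symm
  · intro d _ _ e _ _ h
    exact DFunLike.coe_injective h
  · intro b _ hb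
    refine ⟨Finsupp.equivFunOnFinite.symm b, ?_, by simpa using hb, by simp⟩
    exact mem_support_iff.2 (left_ne_zero_of_mul hb)
  · intro d _ _
    simp

/-- The form of degree `∑ i, a i` vanishing at all other lattice points of its simplex. -/
noncomputable def latticeForm {n : ℕ} (s : ℕ) (a : Fin n → ℕ) : MvPolynomial (Fin n) ℂ :=
  ∏ i, ∏ j ∈ range (a i), (X i - C ((j : ℂ) / s) * ∑ k, X k)

theorem latticeForm_isHomogeneous {n : ℕ} (s : ℕ) (a : Fin n → ℕ) :
    (latticeForm s a).IsHomogeneous (∑ i, a i) := by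
  refine IsHomogeneous.prod _ _ _ fun i _ => ?_
  have h := IsHomogeneous.prod (range (a i))
    (fun j : ℕ => (X i - C ((j : ℂ) / s) * ∑ k, X k : MvPolynomial (Fin n) ℂ)) (fun _ => 1)
    fun j _ => (isHomogeneous_X ℂ i).sub
      ((IsHomogeneous.sum _ _ _ fun k _ => isHomogeneous_X ℂ k).C_mul _)
  simpa using h

/-- On the simplex `(∑ k, X k) / s` equals 1, so it homogenizes the constants `j`. -/
theorem eval_latticeForm {n s : ℕ} (hs : s ≠ 0) (a b : Fin n → ℕ) (hb : ∑ i, b i = s) :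
    eval (fun i => (b i : ℂ)) (latticeForm s a) = ∏ i, ∏ j ∈ range (a i), ((b i : ℂ) - j) := by
  have hs' : (s : ℂ) ≠ 0 := by exact_mod_cast hs
  have hb' : ∑ i, (b i : ℂ) = s := by exact_mod_cast hb
  simp [latticeForm, hb', hs']

theorem eval_latticeForm_self_ne_zero {n s : ℕ} (hs : s ≠ 0) (a : Fin n → ℕ)
    (ha : ∑ i, a i = s) : eval (fun i => (a i : ℂ)) (latticeForm s a) ≠ 0 := by
  rw [eval_latticeForm hs a a ha]
  refine prod_ne_zero_iff.2 fun i _ => prod_ne_zero_iff.2 fun j hj => ?_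
  rw [sub_ne_zero]
  exact_mod_cast (mem_range.1 hj).ne'

theorem eval_latticeForm_of_ne {n s : ℕ} (hs : s ≠ 0) (a b : Fin n → ℕ)
    (ha : ∑ i, a i = s) (hb : ∑ i, b i = s) (hab : a ≠ b) :
    eval (fun i => (b i : ℂ)) (latticeForm s a) = 0 := by
  rw [eval_latticeForm hs a b hb]
  obtain ⟨i, hi⟩ : ∃ i, b i < a i := by
    by_contra! h
    exact hab (funext fun i =>
      (sum_eq_sum_iff_of_le fun i _ => h i).1 (ha.trans hb.symm) i (mem_univ i))
  exact prod_eq_zero (mem_univ i) (prod_eq_zero (mem_range.2 hi) (sub_self _))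

/-- The moment problem at the lattice points of the simplex is solvable. -/
theorem exists_lattice_weights {n s : ℕ} (hs : s ≠ 0) (w : (Fin n → ℕ) → ℂ) :
    ∃ c : (Fin n → ℕ) → ℂ, ∀ b ∈ piAntidiag (univ : Finset (Fin n)) s,
      ∑ a ∈ piAntidiag univ s, c a * ∏ i, (a i : ℂ) ^ b i = w b := by
  set T := piAntidiag (univ : Finset (Fin n)) s with hT
  have hmem : ∀ a : T, ∑ i, a.1 i = s := fun a => (mem_piAntidiag.1 a.2).1
  -- Row `a` holds the coefficients of the Lagrange form at `a`, so `N * P` tabulates the values of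
  -- these forms at the lattice points.
  let N : Matrix T T ℂ := .of fun a b =>
    (eval (fun i => (a.1 i : ℂ)) (latticeForm s a.1))⁻¹ *
      (latticeForm s a.1).coeff (Finsupp.equivFunOnFinite.symm b.1)
  let P : Matrix T T ℂ := .of fun b a => ∏ i, (a.1 i : ℂ) ^ b.1 i
  have hNP : N * P = 1 := by
    ext a a'
    have h := eval_eq_sum_piAntidiag ((hmem a) ▸ latticeForm_isHomogeneous s a.1)
      (fun i => (a'.1 i : ℂ))
    rw [← hT, ← sum_coe_sort] at h
    simp only [Matrix.mul_apply, N, P, Matrix.of_apply, mul_assoc]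
    rw [← mul_sum, ← h, Matrix.one_apply]
    split_ifs with haa
    · subst haa
      exact inv_mul_cancel₀ (eval_latticeForm_self_ne_zero hs _ (hmem a))
    · rw [eval_latticeForm_of_ne hs _ _ (hmem a) (hmem a') (fun h => haa (Subtype.ext h)),
        mul_zero]
  have hPN : P * N = 1 := mul_eq_one_comm.1 hNP
  classical
  refine ⟨fun a => if h : a ∈ T then N.mulVec (fun b => w b.1) ⟨a, h⟩ else 0, fun b hb => ?_⟩
  have h := congrFun (show P.mulVec (N.mulVec fun b => w b.1) = fun b => w b.1 by
    rw [Matrix.mulVec_mulVec, hPN, Matrix.one_mulVec]) ⟨b, hb⟩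
  rw [← h, ← sum_coe_sort]
  simp only [Matrix.mulVec, dotProduct, P, Matrix.of_apply]
  exact sum_congr rfl fun a _ => by simp [mul_comm]

/-! ### Averaging over signs -/

/-- The support of a family of natural numbers. -/
def natSupport {n : ℕ} (a : Fin n → ℕ) : Finset (Fin n) := univ.filter (a · ≠ 0)

/-- The linear form with coefficients `± v i`, negative for `i ∈ A`. -/
noncomputable def signedForm {n : ℕ} (v : Fin n → ℂ) (A : Finset (Fin n)) :
    MvPolynomial (Fin n) ℂ :=
  ∑ i, (if i ∈ A then -1 else 1) * (C (v i) * X i)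

theorem signedForm_isHomogeneous {n : ℕ} (v : Fin n → ℂ) (A : Finset (Fin n)) :
    (signedForm v A).IsHomogeneous 1 := by
  refine IsHomogeneous.sum _ _ _ fun i _ => ?_
  split_ifs
  · simpa using (isHomogeneous_C_mul_X (v i) i).neg
  · simpa using isHomogeneous_C_mul_X (v i) i

theorem sum_powerset_prod_sign {n : ℕ} {R : Type*} [CommRing R] (S : Finset (Fin n))
    (e : Fin n → ℕ) :
    ∑ A ∈ S.powerset, ∏ i, (if i ∈ A then -1 else 1 : R) ^ e i = ∏ i ∈ S, (1 + (-1) ^ e i) := by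
  rw [prod_one_add]
  refine sum_congr rfl fun A _ => ?_
  simp [ite_pow, prod_ite_mem]

theorem sum_signedForm_pow {n s : ℕ} (a : Fin n → ℕ) (v : Fin n → ℂ)
    (hv : ∀ i, v i ^ 2 = a i) :
    ∑ A ∈ (natSupport a).powerset, signedForm v A ^ (2 * s) =
      ∑ b ∈ piAntidiag univ s, C (2 ^ (natSupport a).card *
        Nat.multinomial univ (fun i => 2 * b i) * ∏ i, (a i : ℂ) ^ b i) *
        ∏ i, (X i : MvPolynomial (Fin n) ℂ) ^ (2 * b i) := by
  have h1 : ∑ A ∈ (natSupport a).powerset, signedForm v A ^ (2 * s) =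
      ∑ e ∈ piAntidiag univ (2 * s), (Nat.multinomial univ e : MvPolynomial (Fin n) ℂ) *
        ((∏ i ∈ natSupport a, (1 + (-1) ^ e i)) * ∏ i, (C (v i) * X i) ^ e i) := by
    simp_rw [signedForm, sum_pow_eq_sum_piAntidiag]
    rw [sum_comm]
    refine sum_congr rfl fun e _ => ?_
    simp_rw [← sum_powerset_prod_sign, ← mul_sum, mul_pow, prod_mul_distrib, sum_mul]
  rw [h1]
  symm
  refine sum_of_injOn (fun b i => 2 * b i) ?_ ?_ ?_ ?_
  · intro b _ b' _ h
    funext i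
    have := congrFun h i
    simp only at this
    omega
  · intro b hb
    have hb' := (mem_piAntidiag.1 (mem_coe.1 hb)).1
    simp [← mul_sum, hb']
  · intro e he hne
    obtain ⟨i, hi⟩ : ∃ i, Odd (e i) := by
      by_contra! h
      simp only [Nat.not_odd_iff_even] at h
      refine hne ⟨fun i => e i / 2, ?_, funext fun i => Nat.two_mul_div_two_of_even (h i)⟩
      have he' := (mem_piAntidiag.1 he).1
      have h2 : 2 * ∑ i, e i / 2 = 2 * s := by
        rw [← he', mul_sum]
        exact sum_congr rfl fun i _ => Nat.two_mul_div_two_of_even (h i)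
      simp
      omega
    -- An odd exponent off the support meets the coefficient `v i = 0`; on the support the two signs
    -- cancel.
    by_cases hia : a i = 0
    · have hvi : v i = 0 := by simpa [hia] using hv i
      rw [prod_eq_zero (i := i) (s := univ) (mem_univ i), mul_zero, mul_zero]
      simp [hvi, hi.pos.ne']
    · rw [prod_eq_zero (i := i) (s := natSupport a) (by simp [natSupport, hia]), zero_mul,
        mul_zero]
      simp [hi.neg_one_pow]
  · intro b _
    have h2 : (1 + 1 : MvPolynomial (Fin n) ℂ) = C 2 := by
      rw [one_add_one_eq_two]; exact (map_ofNat _ 2).symm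
    have h3 : ∀ i, (C (v i) : MvPolynomial (Fin n) ℂ) ^ 2 = a i := fun i => by
      rw [← map_pow, hv, map_natCast]
    simp only [pow_mul, mul_pow, prod_mul_distrib, even_two, Even.neg_pow, one_pow, prod_const, h2,
      h3, map_mul, map_prod, map_natCast, map_pow]
    ring

theorem quadForm_pow_eq_sum {n : ℕ} (s : ℕ) :
    quadForm n ^ s = ∑ b ∈ piAntidiag (univ : Finset (Fin n)) s,
      C (Nat.multinomial univ b : ℂ) * ∏ i, (X i : MvPolynomial (Fin n) ℂ) ^ (2 * b i) := by
  simp [quadForm, sum_pow_eq_sum_piAntidiag, pow_mul]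

/-- A power of the quadratic form is a combination of powers of the signed forms
`∑ ± √(a i) x i`, where `a` runs over the lattice points of the simplex. -/
theorem exists_quadForm_pow_eq {n s : ℕ} (hs : s ≠ 0) (v : (Fin n → ℕ) → Fin n → ℂ)
    (hv : ∀ a i, v a i ^ 2 = a i) :
    ∃ c : (Fin n → ℕ) → ℂ, quadForm n ^ s = ∑ a ∈ piAntidiag univ s,
      ∑ A ∈ (natSupport a).powerset, C (c a) * signedForm (v a) A ^ (2 * s) := by
  -- The ratio of the coefficients of `x^(2b)` in `q_n^s` and in `(∑ x i)^(2s)`.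
  obtain ⟨c, hc⟩ := exists_lattice_weights (n := n) hs fun b =>
    (Nat.multinomial univ b : ℂ) / Nat.multinomial univ (fun i => 2 * b i)
  refine ⟨fun a => c a / 2 ^ (natSupport a).card, ?_⟩
  simp_rw [← mul_sum, sum_signedForm_pow _ _ (hv _)]
  rw [quadForm_pow_eq_sum]
  simp_rw [mul_sum]
  rw [sum_comm]
  refine sum_congr rfl fun b hb => ?_
  have hm : (Nat.multinomial univ (fun i => 2 * b i) : ℂ) ≠ 0 := by
    exact_mod_cast (Nat.multinomial_pos _ _).ne'
  rw [← (eq_div_iff hm).1 (hc b hb), sum_mul, map_sum, sum_mul]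
  refine sum_congr rfl fun a _ => ?_
  rw [← mul_assoc, ← map_mul]
  congr 2
  field_simp

/-! ### Counting the powers -/

/-- The partition formed by the nonzero entries of a family of natural numbers. -/
def partitionOfFun {n s : ℕ} (a : Fin n → ℕ) (ha : ∑ i, a i = s) : s.Partition where
  parts := (natSupport a).val.map a
  parts_pos := by
    intro i hi
    obtain ⟨j, hj, rfl⟩ := Multiset.mem_map.1 hi
    exact Nat.pos_of_ne_zero (mem_filter.1 (mem_def.2 hj)).2
  parts_sum := by
    rw [← ha]
    exact sum_filter_ne_zero univ

/-- A point is determined by its support and the list of its values there, which is one of at most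
`k!` orderings of a partition of `s`. -/
theorem card_filter_natSupport_le (n s k : ℕ) :
    ((piAntidiag (univ : Finset (Fin n)) s).filter fun a => (natSupport a).card = k).card ≤
      n.choose k * (kPartition k s * k.factorial) := by
  let Q : Finset s.Partition := univ.filter fun p => p.parts.card = k
  let U : Finset (List ℕ) := Q.biUnion fun p => p.parts.toList.permutations.toFinset
  have hQ : Q.card = kPartition k s := (Fintype.card_subtype _).symm
  have hU : U.card ≤ kPartition k s * k.factorial := by
    rw [← hQ]
    refine card_biUnion_le_card_mul _ _ _ fun p hp => ?_
    refine (List.toFinset_card_le _).trans ?_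
    rw [List.length_permutations, Multiset.length_toList, (mem_filter.1 hp).2]
  have hT : ((powersetCard k (univ : Finset (Fin n))) ×ˢ U).card ≤
      n.choose k * (kPartition k s * k.factorial) := by
    rw [card_product, card_powersetCard, card_univ, Fintype.card_fin]
    exact Nat.mul_le_mul_left _ hU
  refine le_trans (card_le_card_of_injOn
    (fun a => (natSupport a, (natSupport a).toList.map a)) ?_ ?_) hT
  · intro a ha
    obtain ⟨ha, hk⟩ := mem_filter.1 (mem_coe.1 ha)
    have has := (mem_piAntidiag.1 ha).1
    refine mem_coe.2 (mem_product.2 ⟨mem_powersetCard.2 ⟨subset_univ _, hk⟩, ?_⟩)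
    refine mem_biUnion.2 ⟨partitionOfFun a has, ?_, ?_⟩
    · simpa [Q, partitionOfFun] using hk
    · rw [List.mem_toFinset, List.mem_permutations, ← Multiset.coe_eq_coe, Multiset.coe_toList,
        ← Multiset.map_coe, Finset.coe_toList]
      rfl
  · intro a _ b _ hab
    obtain ⟨h1, h2⟩ := Prod.ext_iff.1 hab
    simp only at h1 h2
    rw [← h1, List.map_inj_left] at h2
    funext i
    by_cases hi : i ∈ natSupport a
    · exact h2 i (mem_toList.2 hi)
    · have hb : i ∉ natSupport b := h1 ▸ hi
      simp only [natSupport, mem_filter, mem_univ, true_and, not_not] at hi hb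
      rw [hi, hb]

theorem natSupport_card_mem_Icc {n s : ℕ} (hs : s ≠ 0) {a : Fin n → ℕ} (ha : ∑ i, a i = s) :
    (natSupport a).card ∈ Icc 1 s := by
  rw [mem_Icc]
  constructor
  · rw [Nat.one_le_iff_ne_zero, Ne, card_eq_zero]
    intro h
    apply hs
    rw [← ha, ← sum_filter_ne_zero univ]
    exact (congrArg (fun S => ∑ i ∈ S, a i) h).trans sum_empty
  · rw [← ha, ← sum_filter_ne_zero univ, card_eq_sum_ones]
    exact sum_le_sum fun i hi => Nat.one_le_iff_ne_zero.2 (mem_filter.1 hi).2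

theorem sum_two_pow_natSupport_le {n s : ℕ} (hs : s ≠ 0) :
    ∑ a ∈ piAntidiag (univ : Finset (Fin n)) s, 2 ^ (natSupport a).card ≤
      ∑ k ∈ Icc 1 s, 2 ^ k * k.factorial * kPartition k s * n.choose k := by
  rw [← sum_fiberwise_of_maps_to
    fun a ha => natSupport_card_mem_Icc hs (mem_piAntidiag.1 ha).1]
  refine sum_le_sum fun k _ => ?_
  rw [sum_congr rfl fun a ha => by rw [(mem_filter.1 ha).2], sum_const, smul_eq_mul]
  calc _ ≤ n.choose k * (kPartition k s * k.factorial) * 2 ^ k :=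
        Nat.mul_le_mul_right _ (card_filter_natSupport_le n s k)
    _ = _ := by ring

theorem mainTheorem4 (n s : ℕ) (hs : 1 ≤ s) :
    waringRank (2 * s) (quadForm n ^ s) ≤
      ((∑ k ∈ Finset.Icc 1 s,
        2 ^ k * Nat.factorial k * kPartition k s * Nat.choose n k : ℕ) : ℕ∞) := by
  have hs0 : s ≠ 0 := by omega
  choose root hroot using fun m : ℕ => IsAlgClosed.exists_pow_nat_eq (m : ℂ) two_pos
  obtain ⟨c, hc⟩ := exists_quadForm_pow_eq (n := n) hs0 (fun a i => root (a i))
    fun a i => hroot (a i)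
  rw [hc, sum_sigma']
  refine (waringRank_sum_le_card (by omega) _ (fun p : (_ : Fin n → ℕ) × Finset (Fin n) => c p.1)
    (fun p => signedForm (fun i => root (p.1 i)) p.2)
    fun p _ => signedForm_isHomogeneous _ _).trans ?_
  rw [card_sigma]
  simp_rw [card_powerset]
  exact_mod_cast sum_two_pow_natSupport_le hs0
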